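/- Let $p>1$, $0<h\le 1$ with $ph>1$, and let $\alpha>0$, $C_1,C_2>0$, $A_{p,h}\ge 0$. Let $(\Omega,\mathcal F,\{\mathcal F_t\}_{t\ge 0},\mathbb P)$ be a filtered probability space satisfying the usual conditions, let $T>0$, and let $\{X_t\}_{t\in[0,T]}$ be a continuous $\{\mathcal F_t\}$-adapted process with values in $\mathbb R^d$ such that $X_t\in L^p(\Omega,\mathbb R^d)$ for all $t\in[0,T]$, $$\mathbb E\big[\,|\mathbb E(X_t\mid\mathcal F_s)-X_s|^p\,\big]\le A_{p,h}\,|t-s|^{ph}\qquad\text{for all }0\le s<t\le T,$$ and $$\mathbb P(|X_t|\ge\lambda)\le C_2\exp(-C_1\lambda^\alpha)\qquad\text{for all }\lambda>0\text{ and all }t\in[0,T].$$ Then $$\mathbb P\Big(\sup_{t\in[0,T]}|X_t|\ge\lambda\Big)\le C\,\lambda^{-1/h}\exp\Big[-\frac{C_1}{2^{\alpha+2}}\Big(1-\frac1{ph}\Big)\lambda^\alpha\Big]$$ for all $\lambda\ge\lambda_0$, where the constant $C$ depends only on $(C_1,C_2,\alpha,p,h,A_{p,h})$ and the threshold $\lambda_0>0$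 depends only on these parameters and on $T$. -/

import Mathlib

open MeasureTheory
open scoped NNReal ENNReal

/-- The usual conditions on a filtered probability space `(Ω, mΩ, ℱ, μ)`: the measure is complete,
every null set belongs to `ℱ 0`, and the filtration is right-continuous. -/
structure UsualConditions {Ω : Type*} {mΩ : MeasurableSpace Ω}
    (μ : Measure Ω) (ℱ : Filtration ℝ≥0 mΩ) : Prop where
  complete : μ.IsComplete
  null_mem : ∀ s : Set Ω, μ s = 0 → MeasurableSet[ℱ 0] s
  right_cont : ∀ t : ℝ≥0, ⨅ u > t, ℱ u = ℱ t

/-- `X` is a process with time interval `[0, T]` (only the values `X t` with `t ≤ T` matter) that is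
adapted, has almost surely continuous paths on `[0, T]`, has `p`-integrable margins, and satisfies
the conditional increment control
`𝔼 |𝔼(X_t | ℱ_s) - X_s| ^ p ≤ A * |t - s| ^ (p h)` for `0 ≤ s < t ≤ T`.
The expectation of the nonnegative random variable is written as a lower Lebesgue integral. -/
structure ConditionalIncrementControl {Ω E : Type*} {mΩ : MeasurableSpace Ω}
    [NormedAddCommGroup E] [NormedSpace ℝ E] [CompleteSpace E]
    (μ : Measure Ω) (ℱ : Filtration ℝ≥0 mΩ) (T : ℝ≥0) (X : ℝ≥0 → Ω → E)
    (p h A : ℝ) : Prop where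
  adapted : ∀ t ≤ T, StronglyMeasurable[ℱ t] (X t)
  continuous_paths : ∀ᵐ ω ∂μ, ContinuousOn (fun t => X t ω) (Set.Icc 0 T)
  memLp : ∀ t ≤ T, MemLp (X t) (ENNReal.ofReal p) μ
  control : ∀ s t : ℝ≥0, s < t → t ≤ T →
    ∫⁻ ω, ‖(μ[X t | ℱ s]) ω - X s ω‖ₑ ^ p ∂μ
      ≤ ENNReal.ofReal (A * ((t : ℝ) - (s : ℝ)) ^ (p * h))

/-- Uniform `α`-exponential marginal decay on `[0, T]` with constants `C₁`, `C₂`. -/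
def UniformExpMarginalDecay {Ω E : Type*} {mΩ : MeasurableSpace Ω} [NormedAddCommGroup E]
    (μ : Measure Ω) (T : ℝ≥0) (X : ℝ≥0 → Ω → E) (α C₁ C₂ : ℝ) : Prop :=
  ∀ lam : ℝ, 0 < lam → ∀ t ≤ T,
    μ.real {ω | lam ≤ ‖X t ω‖} ≤ C₂ * Real.exp (-C₁ * lam ^ α)

/-!
Along the dyadic refinements of a partition of `[0, T]` into `n` cells, the values of `X` on the
grid are dominated by conditional expectations of one integrable majorant: at a new grid point `u`
with old right neighbour `v`, `‖X u‖ ≤ 𝔼(‖X v‖ | ℱ u) + ‖𝔼(X v | ℱ u) - X u‖`, and the last term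
is at most `w + w ^ (1 - p) * ‖𝔼(X v | ℱ u) - X u‖ ^ p` for any weight `w > 0`. Doob's inequality
then bounds the probability of a large maximum by the mean of the majorant above a constant. If the
truncation level is close to `λ`, that mean has a part of order `n * exp (-γ * λ ^ α)` from the
marginal tails on the initial partition, with `γ < C₁` as close to `C₁` as desired, and, with
geometrically decaying weights, a part of order `n ^ (1 - p * h)` from the increments. The choice
`n ≈ exp (γ * λ ^ α / (p * h))` balances the two at the rate `γ * (1 - 1 / (p * h))`.
-/

open Filter Topology

section ConditionalExpectation

variable {Ω E : Type*} {m m₀ : MeasurableSpace Ω} {μ : Measure Ω} [IsFiniteMeasure μ]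

lemma ae_le_condExp_of_stronglyMeasurable (hm : m ≤ m₀) {f g : Ω → ℝ}
    (hf : StronglyMeasurable[m] f) (hf_int : Integrable f μ) (hg : Integrable g μ)
    (hfg : f ≤ᵐ[μ] g) : f ≤ᵐ[μ] μ[g | m] := by
  have h := condExp_mono (m := m) hf_int hg hfg
  rwa [condExp_of_stronglyMeasurable hm hf hf_int] at h

lemma condExp_const_add (hm : m ≤ m₀) (b : ℝ) {f : Ω → ℝ} (hf : Integrable f μ) :
    μ[fun ω => b + f ω | m] =ᵐ[μ] fun ω => b + (μ[f | m]) ω := by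
  have h := condExp_add (integrable_const (μ := μ) b) hf m
  rwa [condExp_const hm] at h

lemma ae_norm_le_condExp_of_add_norm_condExp_sub_le [NormedAddCommGroup E] [NormedSpace ℝ E]
    [CompleteSpace E] {m' : MeasurableSpace Ω} (hmm' : m ≤ m') (hm' : m' ≤ m₀) {Y Z : Ω → E}
    {S S' : Ω → ℝ} (hY : Integrable Y μ) (hZm : StronglyMeasurable[m] Z) (hZ : Integrable Z μ)
    (hS : Integrable S μ) (hS' : Integrable S' μ) (hYS : ∀ᵐ ω ∂μ, ‖Y ω‖ ≤ (μ[S | m']) ω)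
    (hSS' : ∀ᵐ ω ∂μ, S ω + ‖(μ[Y | m]) ω - Z ω‖ ≤ S' ω) :
    ∀ᵐ ω ∂μ, ‖Z ω‖ ≤ (μ[S' | m]) ω := by
  have hm : m ≤ m₀ := hmm'.trans hm'
  set ξ : Ω → E := fun ω => (μ[Y | m]) ω - Z ω
  have hξm : StronglyMeasurable[m] ξ := stronglyMeasurable_condExp.sub hZm
  have hξ : Integrable ξ μ := integrable_condExp.sub hZ
  have hY_le : (fun ω => ‖(μ[Y | m]) ω‖) ≤ᵐ[μ] μ[S | m] :=
    calc _ ≤ᵐ[μ] μ[fun ω => ‖Y ω‖ | m] := norm_condExp_le Y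
      _ ≤ᵐ[μ] μ[μ[S | m'] | m] := condExp_mono hY.norm integrable_condExp hYS
      _ =ᵐ[μ] μ[S | m] := condExp_condExp_of_le hmm' hm'
  have hadd : μ[S | m] + (fun ω => ‖ξ ω‖) ≤ᵐ[μ] μ[S' | m] := by
    have h := condExp_add hS hξ.norm m
    rw [condExp_of_stronglyMeasurable hm hξm.norm hξ.norm] at h
    exact h.symm.le.trans (condExp_mono (hS.add hξ.norm) hS' hSS')
  filter_upwards [hY_le, hadd] with ω hω hω'
  calc ‖Z ω‖ = ‖(μ[Y | m]) ω - ξ ω‖ := by rw [sub_sub_cancel]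
    _ ≤ ‖(μ[Y | m]) ω‖ + ‖ξ ω‖ := norm_sub_le _ _
    _ ≤ (μ[S | m]) ω + ‖ξ ω‖ := by gcongr
    _ ≤ (μ[S' | m]) ω := hω'

lemma measure_exists_le_condExp_le (𝒢 : Filtration ℕ m₀) {V : Ω → ℝ} (hV : 0 ≤ᵐ[μ] V)
    {ε : ℝ} (hε : 0 < ε) (k : ℕ) :
    μ {ω | ∃ j ≤ k, ε ≤ (μ[V | 𝒢 j]) ω} ≤ ENNReal.ofReal ((∫ ω, V ω ∂μ) / ε) := by
  have hsub : Submartingale (fun j => μ[V | 𝒢 j])⁺ 𝒢 μ :=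
    (martingale_condExp V 𝒢 μ).submartingale.pos
  have hmean : ∫ ω, ((fun j => μ[V | 𝒢 j])⁺) k ω ∂μ = ∫ ω, V ω ∂μ := by
    rw [← integral_condExp (𝒢.le k) (f := V)]
    refine integral_congr_ae ?_
    filter_upwards [condExp_nonneg (m := 𝒢 k) hV] with ω hω
    simpa using hω
  lift ε to ℝ≥0 using hε.le
  rw [ENNReal.ofReal_div_of_pos hε, ENNReal.ofReal_coe_nnreal, ENNReal.le_div_iff_mul_le
    (Or.inl (by simpa using hε.ne')) (Or.inl ENNReal.coe_ne_top), mul_comm, ← hmean]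
  calc (ε : ℝ≥0∞) * μ {ω | ∃ j ≤ k, (ε : ℝ) ≤ (μ[V | 𝒢 j]) ω}
    _ ≤ ε * μ {ω | (ε : ℝ) ≤ (Finset.range (k + 1)).sup' Finset.nonempty_range_add_one
          fun j => ((fun j => μ[V | 𝒢 j])⁺) j ω} := by
        gcongr with ω
        rintro ⟨j, hj, hω⟩
        exact (hω.trans (le_posPart _)).trans
          (Finset.le_sup' (fun j => ((fun j => μ[V | 𝒢 j])⁺) j ω)
            (Finset.mem_range_succ_iff.2 hj))
    _ ≤ _ := maximal_ineq hsub (fun j ω => posPart_nonneg _) k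
    _ ≤ _ := ENNReal.ofReal_le_ofReal (setIntegral_le_integral (hsub.integrable k)
        (Eventually.of_forall fun ω => posPart_nonneg _))

lemma measure_exists_add_le_of_le_condExp {ι : Type*} [Preorder ι] (ℱ : Filtration ι m₀)
    {τ : ℕ → ι} (hτ : Monotone τ) {Z : ℕ → Ω → ℝ} {V : Ω → ℝ} (hV : 0 ≤ᵐ[μ] V)
    (hV_int : Integrable V μ) {b ε : ℝ} (hε : 0 < ε) {k : ℕ}
    (hZ : ∀ j ≤ k, ∀ᵐ ω ∂μ, Z j ω ≤ (μ[fun ω => b + V ω | ℱ (τ j)]) ω) :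
    μ {ω | ∃ j ≤ k, b + ε ≤ Z j ω} ≤ ENNReal.ofReal ((∫ ω, V ω ∂μ) / ε) := by
  let 𝒢 : Filtration ℕ m₀ :=
    { seq := fun j => ℱ (τ j)
      mono' := fun _ _ hij => ℱ.mono (hτ hij)
      le' := fun j => ℱ.le (τ j) }
  have hZ' : ∀ᵐ ω ∂μ, ∀ j ≤ k, Z j ω ≤ b + (μ[V | 𝒢 j]) ω := by
    refine ae_all_iff.2 fun j => eventually_imp_distrib_left.2 fun hj => ?_
    filter_upwards [hZ j hj, condExp_const_add (𝒢.le j) b hV_int] with ω h₁ h₂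
    exact h₁.trans_eq h₂
  refine (measure_mono_ae ?_).trans (measure_exists_le_condExp_le 𝒢 hV hε k)
  filter_upwards [hZ'] with ω hω
  rintro ⟨j, hj, hle⟩
  exact ⟨j, hj, by linarith [hω j hj]⟩

end ConditionalExpectation

section Moments

variable {Ω E : Type*} {mΩ : MeasurableSpace Ω} {μ : Measure Ω} [NormedAddCommGroup E]

lemma integrable_norm_rpow_and_integral_le {Y : Ω → E} (hY : AEStronglyMeasurable Y μ) {p B : ℝ}
    (hp : 0 ≤ p) (hB : 0 ≤ B) (h : ∫⁻ ω, ‖Y ω‖ₑ ^ p ∂μ ≤ ENNReal.ofReal B) :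
    Integrable (fun ω => ‖Y ω‖ ^ p) μ ∧ ∫ ω, ‖Y ω‖ ^ p ∂μ ≤ B := by
  have hm : AEStronglyMeasurable (fun ω => ‖Y ω‖ ^ p) μ :=
    (Real.continuous_rpow_const hp).comp_aestronglyMeasurable hY.norm
  have hnonneg : 0 ≤ᵐ[μ] fun ω => ‖Y ω‖ ^ p := Eventually.of_forall fun ω => by positivity
  have henorm : ∫⁻ ω, ENNReal.ofReal (‖Y ω‖ ^ p) ∂μ = ∫⁻ ω, ‖Y ω‖ₑ ^ p ∂μ := by
    simp only [← ENNReal.ofReal_rpow_of_nonneg (norm_nonneg _) hp, ofReal_norm]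
  constructor
  · refine ⟨hm, (hasFiniteIntegral_iff_ofReal hnonneg).2 ?_⟩
    exact (henorm.trans_le h).trans_lt ENNReal.ofReal_lt_top
  · rw [integral_eq_lintegral_of_nonneg_ae hnonneg hm, henorm]
    exact ENNReal.toReal_le_of_le_ofReal hB h

lemma integral_max_norm_sub_le_of_exp_tail [IsFiniteMeasure μ] {Y : Ω → E} (hY : Integrable Y μ)
    {α C₁ C₂ γ : ℝ} (hα : 0 < α) (hγ : 0 ≤ γ) (hγC₁ : γ < C₁) (hC₂ : 0 ≤ C₂)
    (htail : ∀ r : ℝ, 0 < r → μ.real {ω | r ≤ ‖Y ω‖} ≤ C₂ * Real.exp (-C₁ * r ^ α))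
    {c : ℝ} (hc : 0 ≤ c) :
    ∫ ω, max (‖Y ω‖ - c) 0 ∂μ ≤
      (C₂ * ∫ t in Set.Ioi (0 : ℝ), Real.exp (-(C₁ - γ) * t ^ α)) * Real.exp (-γ * c ^ α) := by
  have hexp : IntegrableOn (fun t : ℝ => Real.exp (-(C₁ - γ) * t ^ α)) (Set.Ioi 0) := by
    simpa using integrableOn_rpow_mul_exp_neg_mul_rpow (s := 0) (by norm_num) hα (sub_pos.2 hγC₁)
  have hexcess : Integrable (fun ω => max (‖Y ω‖ - c) 0) μ :=
    (hY.norm.sub (integrable_const c)).pos_part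
  rw [hexcess.integral_eq_integral_meas_le (Eventually.of_forall fun ω => le_max_right _ _),
    ← integral_const_mul, ← integral_mul_const]
  refine integral_mono_of_nonneg (Eventually.of_forall fun _ => measureReal_nonneg)
    ((hexp.const_mul _).mul_const _) (ae_restrict_of_forall_mem measurableSet_Ioi fun t ht => ?_)
  replace ht : 0 < t := ht
  have hset : {ω | t ≤ max (‖Y ω‖ - c) 0} = {ω | t + c ≤ ‖Y ω‖} := by
    ext ω
    simp only [Set.mem_ofPred_eq, le_max_iff, not_le.2 ht, or_false, le_sub_iff_add_le]
  have ht_le : t ^ α ≤ (t + c) ^ α := Real.rpow_le_rpow ht.le (by linarith) hα.le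
  have hc_le : c ^ α ≤ (t + c) ^ α := Real.rpow_le_rpow hc (by linarith) hα.le
  calc μ.real {ω | t ≤ max (‖Y ω‖ - c) 0}
    _ ≤ C₂ * Real.exp (-C₁ * (t + c) ^ α) := hset ▸ htail _ (by linarith)
    _ ≤ C₂ * Real.exp (-(C₁ - γ) * t ^ α + -γ * c ^ α) := by gcongr; nlinarith
    _ = C₂ * Real.exp (-(C₁ - γ) * t ^ α) * Real.exp (-γ * c ^ α) := by rw [Real.exp_add, mul_assoc]

end Moments

lemma le_add_rpow_mul_rpow {p w x : ℝ} (hp : 1 ≤ p) (hw : 0 < w) (hx : 0 ≤ x) :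
    x ≤ w + w ^ (1 - p) * x ^ p := by
  rcases le_total x w with hxw | hwx
  · have : 0 ≤ w ^ (1 - p) * x ^ p := by positivity
    linarith
  · have hx_pos : 0 < x := hw.trans_le hwx
    calc x = x ^ (1 - p) * x ^ p := by rw [← Real.rpow_add hx_pos]; simp
      _ ≤ w ^ (1 - p) * x ^ p := by
        gcongr ?_ * _
        exact Real.rpow_le_rpow_of_nonpos hw hwx (by linarith)
      _ ≤ w + w ^ (1 - p) * x ^ p := le_add_of_nonneg_left hw.le

/-- The `j`-th point of the uniform grid of `[0, T]` with `n * 2 ^ N` cells: the partition into `n`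
cells after `N` dyadic refinements. -/
noncomputable def gridPoint (T : ℝ≥0) (n N j : ℕ) : ℝ≥0 := T * (j / (n * 2 ^ N))

namespace gridPoint

variable {T : ℝ≥0} {n : ℕ}

lemma monotone (N : ℕ) : Monotone (gridPoint T n N) := by
  intro i j hij
  unfold gridPoint
  gcongr

lemma succ_two_mul (N j : ℕ) : gridPoint T n (N + 1) (2 * j) = gridPoint T n N j := by
  unfold gridPoint
  rw [pow_succ, mul_comm ((2 : ℝ≥0) ^ N) 2, mul_left_comm]
  push_cast
  rw [mul_div_mul_left _ _ two_ne_zero]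

lemma le {N j : ℕ} (hj : j ≤ n * 2 ^ N) : gridPoint T n N j ≤ T :=
  mul_le_of_le_one_right' (div_le_one_of_le₀ (by exact_mod_cast hj) zero_le)

lemma coe_succ_sub_coe (N j : ℕ) :
    (gridPoint T n N (j + 1) : ℝ) - gridPoint T n N j = T / (n * 2 ^ N) := by
  unfold gridPoint
  push_cast
  ring

lemma lt_succ (hT : 0 < T) (hn : 0 < n) (N j : ℕ) :
    gridPoint T n N j < gridPoint T n N (j + 1) := by
  have hmesh : (0 : ℝ) < T / (n * 2 ^ N) := by positivity
  rw [← coe_succ_sub_coe N j] at hmesh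
  exact_mod_cast sub_pos.1 hmesh

lemma floor_le {t : ℝ≥0} (ht : t ≤ T) (N : ℕ) :
    ⌊(t / T : ℝ) * (n * 2 ^ N)⌋₊ ≤ n * 2 ^ N := by
  refine Nat.floor_le_of_le ?_
  push_cast
  exact mul_le_of_le_one_left (by positivity) (div_le_one_of_le₀ ht T.coe_nonneg)

lemma tendsto_floor (hT : 0 < T) (hn : 0 < n) (t : ℝ≥0) :
    Tendsto (fun N => gridPoint T n N ⌊(t / T : ℝ) * (n * 2 ^ N)⌋₊) atTop (𝓝 t) := by
  have hcells : Tendsto (fun N : ℕ => (n * 2 ^ N : ℝ)) atTop atTop :=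
    (tendsto_pow_atTop_atTop_of_one_lt one_lt_two).const_mul_atTop (by positivity)
  have hratio := (tendsto_nat_floor_mul_div_atTop (a := (t / T : ℝ)) (by positivity)).comp hcells
  have hlim := hratio.const_mul (T : ℝ)
  rw [mul_div_cancel₀ _ (by positivity)] at hlim
  rw [← NNReal.tendsto_coe]
  simpa only [gridPoint, NNReal.coe_mul, NNReal.coe_div, NNReal.coe_natCast, NNReal.coe_pow,
    NNReal.coe_ofNat, Function.comp_def] using hlim

lemma exists_le_norm {E : Type*} [NormedAddCommGroup E] (hT : 0 < T) (hn : 0 < n) {f : ℝ≥0 → E}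
    (hf : ContinuousOn f (Set.Icc 0 T)) {r lam : ℝ} (hlam : 0 < lam) (hr : r < lam)
    (hsup : ENNReal.ofReal lam ≤ ⨆ t ∈ Set.Icc (0 : ℝ≥0) T, ‖f t‖ₑ) :
    ∃ N, ∃ j ≤ n * 2 ^ N, r ≤ ‖f (gridPoint T n N j)‖ := by
  obtain ⟨t, ht, hrt⟩ : ∃ t ∈ Set.Icc 0 T, r < ‖f t‖ := by
    have h := ((ENNReal.ofReal_lt_ofReal_iff hlam).2 hr).trans_le hsup
    simp only [lt_iSup_iff, ← ofReal_norm] at h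
    obtain ⟨t, ht, hrt⟩ := h
    exact ⟨t, ht, (ENNReal.ofReal_lt_ofReal_iff'.1 hrt).1⟩
  have hgrid : Tendsto (fun N => gridPoint T n N ⌊(t / T : ℝ) * (n * 2 ^ N)⌋₊) atTop
      (𝓝[Set.Icc 0 T] t) :=
    tendsto_nhdsWithin_iff.2 ⟨tendsto_floor hT hn t,
      Eventually.of_forall fun N => ⟨zero_le, le (floor_le ht.2 N)⟩⟩
  obtain ⟨N, hN⟩ := (((hf t ht).norm.tendsto.comp hgrid).eventually_const_le hrt).exists
  exact ⟨N, _, floor_le ht.2 N, hN⟩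

lemma measure_le_iSup_enorm_le {Ω E : Type*} {mΩ : MeasurableSpace Ω} [NormedAddCommGroup E]
    {μ : Measure Ω} {X : ℝ≥0 → Ω → E} (hT : 0 < T) (hn : 0 < n)
    (hX : ∀ᵐ ω ∂μ, ContinuousOn (fun t => X t ω) (Set.Icc 0 T))
    {r lam : ℝ} (hlam : 0 < lam) (hr : r < lam) {B : ℝ≥0∞}
    (hB : ∀ N, μ {ω | ∃ j ≤ n * 2 ^ N, r ≤ ‖X (gridPoint T n N j) ω‖} ≤ B) :
    μ {ω | ENNReal.ofReal lam ≤ ⨆ t ∈ Set.Icc (0 : ℝ≥0) T, ‖X t ω‖ₑ} ≤ B := by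
  set D : ℕ → Set Ω := fun N => {ω | ∃ j ≤ n * 2 ^ N, r ≤ ‖X (gridPoint T n N j) ω‖}
  have hD : Monotone D := monotone_nat_of_le_succ fun N ω ⟨j, hj, hrj⟩ =>
    ⟨2 * j, by rw [pow_succ]; lia, by rwa [succ_two_mul]⟩
  calc _ ≤ μ (⋃ N, D N) := by
        refine measure_mono_ae ?_
        filter_upwards [hX] with ω hω hsup
        exact Set.mem_iUnion.2 (exists_le_norm hT hn hω hlam hr hsup)
    _ = ⨆ N, μ (D N) := hD.measure_iUnion
    _ ≤ B := iSup_le hB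

end gridPoint

section Chaining

variable {Ω E : Type*} {mΩ : MeasurableSpace Ω} [NormedAddCommGroup E] [NormedSpace ℝ E]

/-- The increment of `X` over the `j`-th cell of the level-`N` grid, conditioned on the σ-algebra at
the left end of the cell. -/
noncomputable def gridIncrement (μ : Measure Ω) (ℱ : Filtration ℝ≥0 mΩ) (T : ℝ≥0)
    (X : ℝ≥0 → Ω → E) (n N j : ℕ) (ω : Ω) : E :=
  (μ[X (gridPoint T n N (j + 1)) | ℱ (gridPoint T n N j)]) ω - X (gridPoint T n N j) ω

/-- The `p`-variation of the conditional increments of `X` along the level-`N` grid. -/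
noncomputable def gridVariation (μ : Measure Ω) (ℱ : Filtration ℝ≥0 mΩ) (T : ℝ≥0)
    (X : ℝ≥0 → Ω → E) (p : ℝ) (n N : ℕ) (ω : Ω) : ℝ :=
  ∑ j ∈ Finset.range (n * 2 ^ N), ‖gridIncrement μ ℱ T X n N j ω‖ ^ p

/-- The random part of the chaining bound at level `N`: the excess of `‖X‖` over the truncation
level `c` on the initial grid, plus the `p`-variations of all refinements with the weights
`w m ^ (1 - p)` coming from `le_add_rpow_mul_rpow`. -/
noncomputable def chainingError (μ : Measure Ω) (ℱ : Filtration ℝ≥0 mΩ) (T : ℝ≥0)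
    (X : ℝ≥0 → Ω → E) (p c : ℝ) (w : ℕ → ℝ) (n N : ℕ) (ω : Ω) : ℝ :=
  ∑ i ∈ Finset.range (n + 1), max (‖X (gridPoint T n 0 i) ω‖ - c) 0 +
    ∑ m ∈ Finset.range N, w (m + 1) ^ (1 - p) * gridVariation μ ℱ T X p n (m + 1) ω

/-- The variable whose conditional expectations dominate `‖X‖` on the level-`N` grid. -/
noncomputable def chainingMajorant (μ : Measure Ω) (ℱ : Filtration ℝ≥0 mΩ) (T : ℝ≥0)
    (X : ℝ≥0 → Ω → E) (p c : ℝ) (w : ℕ → ℝ) (n N : ℕ) (ω : Ω) : ℝ :=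
  (c + ∑ m ∈ Finset.range N, w (m + 1)) + chainingError μ ℱ T X p c w n N ω

variable {μ : Measure Ω} {ℱ : Filtration ℝ≥0 mΩ} {T : ℝ≥0} {X : ℝ≥0 → Ω → E}
  {p h A c K : ℝ} {w : ℕ → ℝ} {n : ℕ}

lemma gridVariation_nonneg (N : ℕ) (ω : Ω) : 0 ≤ gridVariation μ ℱ T X p n N ω :=
  Finset.sum_nonneg fun _ _ => Real.rpow_nonneg (norm_nonneg _) _

lemma chainingError_nonneg (hw : ∀ m, 0 ≤ w m) (N : ℕ) (ω : Ω) :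
    0 ≤ chainingError μ ℱ T X p c w n N ω :=
  add_nonneg (Finset.sum_nonneg fun _ _ => le_max_right _ _) (Finset.sum_nonneg fun m _ =>
    mul_nonneg (Real.rpow_nonneg (hw (m + 1)) _) (gridVariation_nonneg (m + 1) ω))

lemma chainingMajorant_succ (N : ℕ) (ω : Ω) :
    chainingMajorant μ ℱ T X p c w n (N + 1) ω = chainingMajorant μ ℱ T X p c w n N ω +
      (w (N + 1) + w (N + 1) ^ (1 - p) * gridVariation μ ℱ T X p n (N + 1) ω) := by
  simp only [chainingMajorant, chainingError, Finset.sum_range_succ _ N]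
  ring

lemma norm_le_chainingMajorant_zero {j : ℕ} (hj : j ≤ n) (ω : Ω) :
    ‖X (gridPoint T n 0 j) ω‖ ≤ chainingMajorant μ ℱ T X p c w n 0 ω := by
  have hle : max (‖X (gridPoint T n 0 j) ω‖ - c) 0 ≤
      ∑ i ∈ Finset.range (n + 1), max (‖X (gridPoint T n 0 i) ω‖ - c) 0 :=
    Finset.single_le_sum (f := fun i => max (‖X (gridPoint T n 0 i) ω‖ - c) 0)
      (fun _ _ => le_max_right _ _) (Finset.mem_range_succ_iff.2 hj)
  simp only [chainingMajorant, chainingError, Finset.range_zero, Finset.sum_empty, add_zero]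
  linarith [le_max_left (‖X (gridPoint T n 0 j) ω‖ - c) 0]

lemma chainingMajorant_le_succ (hw : ∀ m, 0 ≤ w m) (N : ℕ) (ω : Ω) :
    chainingMajorant μ ℱ T X p c w n N ω ≤ chainingMajorant μ ℱ T X p c w n (N + 1) ω := by
  rw [chainingMajorant_succ]
  exact le_add_of_nonneg_right (add_nonneg (hw _)
    (mul_nonneg (Real.rpow_nonneg (hw _) _) (gridVariation_nonneg _ ω)))

lemma chainingMajorant_add_norm_gridIncrement_le (hp : 1 ≤ p) (hw : ∀ m, 0 < w m) {N j : ℕ}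
    (hj : j < n * 2 ^ (N + 1)) (ω : Ω) :
    chainingMajorant μ ℱ T X p c w n N ω + ‖gridIncrement μ ℱ T X n (N + 1) j ω‖ ≤
      chainingMajorant μ ℱ T X p c w n (N + 1) ω := by
  have hle : ‖gridIncrement μ ℱ T X n (N + 1) j ω‖ ^ p ≤ gridVariation μ ℱ T X p n (N + 1) ω :=
    Finset.single_le_sum (f := fun j => ‖gridIncrement μ ℱ T X n (N + 1) j ω‖ ^ p)
      (fun _ _ => Real.rpow_nonneg (norm_nonneg _) _) (Finset.mem_range.2 hj)
  rw [chainingMajorant_succ]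
  gcongr
  refine (le_add_rpow_mul_rpow hp (hw (N + 1)) (norm_nonneg _)).trans ?_
  gcongr
  exact Real.rpow_nonneg (hw _).le _

variable [CompleteSpace E] [IsFiniteMeasure μ]

namespace ConditionalIncrementControl

lemma integrable (hX : ConditionalIncrementControl μ ℱ T X p h A) (hp : 1 ≤ p) {t : ℝ≥0}
    (ht : t ≤ T) : Integrable (X t) μ :=
  (hX.memLp t ht).integrable (by simpa using ENNReal.ofReal_le_ofReal hp)

lemma integrable_max_norm_sub (hX : ConditionalIncrementControl μ ℱ T X p h A) (hp : 1 ≤ p)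
    (c : ℝ) {i : ℕ} (hi : i ∈ Finset.range (n + 1)) :
    Integrable (fun ω => max (‖X (gridPoint T n 0 i) ω‖ - c) 0) μ := by
  have hi' : gridPoint T n 0 i ≤ T := gridPoint.le (by simpa [Nat.lt_succ_iff] using hi)
  exact ((hX.integrable hp hi').norm.sub (integrable_const c)).pos_part

lemma integrable_norm_gridIncrement_rpow_and_integral_le
    (hX : ConditionalIncrementControl μ ℱ T X p h A) (hp : 1 ≤ p) (hA : 0 ≤ A) (hT : 0 < T)
    (hn : 0 < n) {N j : ℕ} (hj : j ∈ Finset.range (n * 2 ^ N)) :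
    Integrable (fun ω => ‖gridIncrement μ ℱ T X n N j ω‖ ^ p) μ ∧
      ∫ ω, ‖gridIncrement μ ℱ T X n N j ω‖ ^ p ∂μ ≤ A * (T / (n * 2 ^ N)) ^ (p * h) := by
  have hj' := Finset.mem_range.1 hj
  have hcontrol := hX.control _ _ (gridPoint.lt_succ hT hn N j) (gridPoint.le hj')
  rw [gridPoint.coe_succ_sub_coe] at hcontrol
  refine integrable_norm_rpow_and_integral_le ?_ (by linarith) (by positivity) hcontrol
  exact (integrable_condExp.sub (hX.integrable hp (gridPoint.le hj'.le))).aestronglyMeasurable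

lemma integrable_gridVariation (hX : ConditionalIncrementControl μ ℱ T X p h A) (hp : 1 ≤ p)
    (hA : 0 ≤ A) (hT : 0 < T) (hn : 0 < n) (N : ℕ) :
    Integrable (gridVariation μ ℱ T X p n N) μ :=
  integrable_finsetSum _ fun _ hj =>
    (hX.integrable_norm_gridIncrement_rpow_and_integral_le hp hA hT hn hj).1

lemma integral_gridVariation_le (hX : ConditionalIncrementControl μ ℱ T X p h A) (hp : 1 ≤ p)
    (hA : 0 ≤ A) (hT : 0 < T) (hn : 0 < n) (N : ℕ) :
    ∫ ω, gridVariation μ ℱ T X p n N ω ∂μ ≤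
      (n * 2 ^ N) * (A * (T / (n * 2 ^ N)) ^ (p * h)) := by
  have hincr {j : ℕ} (hj : j ∈ Finset.range (n * 2 ^ N)) :=
    hX.integrable_norm_gridIncrement_rpow_and_integral_le hp hA hT hn hj
  calc ∫ ω, gridVariation μ ℱ T X p n N ω ∂μ
    _ = ∑ j ∈ Finset.range (n * 2 ^ N), ∫ ω, ‖gridIncrement μ ℱ T X n N j ω‖ ^ p ∂μ :=
      integral_finsetSum _ fun _ hj => (hincr hj).1
    _ ≤ (Finset.range (n * 2 ^ N)).card • (A * (T / (n * 2 ^ N)) ^ (p * h)) :=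
      Finset.sum_le_card_nsmul _ _ _ fun _ hj => (hincr hj).2
    _ = _ := by simp

lemma integrable_chainingError (hX : ConditionalIncrementControl μ ℱ T X p h A) (hp : 1 ≤ p)
    (hA : 0 ≤ A) (hT : 0 < T) (hn : 0 < n) (c : ℝ) (w : ℕ → ℝ) (N : ℕ) :
    Integrable (chainingError μ ℱ T X p c w n N) μ :=
  (integrable_finsetSum _ fun _ hi => hX.integrable_max_norm_sub hp c hi).add
    (integrable_finsetSum _ fun m _ =>
      (hX.integrable_gridVariation hp hA hT hn (m + 1)).const_mul _)

lemma integral_chainingError_le (hX : ConditionalIncrementControl μ ℱ T X p h A) (hp : 1 ≤ p)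
    (hA : 0 ≤ A) (hT : 0 < T) (hn : 0 < n) (hw : ∀ m, 0 ≤ w m)
    (hK : ∀ t ≤ T, ∫ ω, max (‖X t ω‖ - c) 0 ∂μ ≤ K) (N : ℕ) :
    ∫ ω, chainingError μ ℱ T X p c w n N ω ∂μ ≤ (n + 1) * K +
      ∑ m ∈ Finset.range N, w (m + 1) ^ (1 - p) *
        ((n * 2 ^ (m + 1)) * (A * (T / (n * 2 ^ (m + 1))) ^ (p * h))) := by
  have hexcess {i : ℕ} (hi : i ∈ Finset.range (n + 1)) := hX.integrable_max_norm_sub hp c hi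
  have hvar (m : ℕ) := (hX.integrable_gridVariation hp hA hT hn (m + 1)).const_mul
    (w (m + 1) ^ (1 - p))
  unfold chainingError
  rw [integral_add (integrable_finsetSum _ fun _ => hexcess) (integrable_finsetSum _ fun m _ =>
    hvar m), integral_finsetSum _ fun _ => hexcess, integral_finsetSum _ fun m _ => hvar m]
  simp only [integral_const_mul]
  gcongr with m
  · refine (Finset.sum_le_card_nsmul _ _ K fun i hi => hK _ (gridPoint.le ?_)).trans_eq (by simp)
    simpa [Nat.lt_succ_iff] using hi
  · exact Real.rpow_nonneg (hw _) _
  · exact hX.integral_gridVariation_le hp hA hT hn (m + 1)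

lemma integrable_chainingMajorant (hX : ConditionalIncrementControl μ ℱ T X p h A) (hp : 1 ≤ p)
    (hA : 0 ≤ A) (hT : 0 < T) (hn : 0 < n) (c : ℝ) (w : ℕ → ℝ) (N : ℕ) :
    Integrable (chainingMajorant μ ℱ T X p c w n N) μ :=
  (integrable_const _).add (hX.integrable_chainingError hp hA hT hn c w N)

lemma ae_norm_grid_le_condExp_chainingMajorant (hX : ConditionalIncrementControl μ ℱ T X p h A)
    (hp : 1 ≤ p) (hA : 0 ≤ A) (hT : 0 < T) (hn : 0 < n) (hw : ∀ m, 0 < w m) (N : ℕ) :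
    ∀ j ≤ n * 2 ^ N, ∀ᵐ ω ∂μ, ‖X (gridPoint T n N j) ω‖ ≤
      (μ[chainingMajorant μ ℱ T X p c w n N | ℱ (gridPoint T n N j)]) ω := by
  have hS := hX.integrable_chainingMajorant hp hA hT hn c w
  induction N with
  | zero =>
    intro j hj
    have hjT := gridPoint.le (T := T) hj
    exact ae_le_condExp_of_stronglyMeasurable (ℱ.le _) (hX.adapted _ hjT).norm
      (hX.integrable hp hjT).norm (hS 0)
      (Eventually.of_forall (norm_le_chainingMajorant_zero (by simpa using hj)))
  | succ N ih =>
    intro j hj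
    obtain ⟨k, rfl | rfl⟩ := Nat.even_or_odd' j
    · rw [gridPoint.succ_two_mul]
      filter_upwards [ih k (by rw [pow_succ] at hj; lia), condExp_mono (hS N) (hS (N + 1))
        (Eventually.of_forall (chainingMajorant_le_succ (fun m => (hw m).le) N))] with ω h₁ h₂
      exact h₁.trans h₂
    · have hk : k + 1 ≤ n * 2 ^ N := by rw [pow_succ] at hj; lia
      have hright : gridPoint T n (N + 1) (2 * k + 1 + 1) = gridPoint T n N (k + 1) :=
        gridPoint.succ_two_mul N (k + 1)
      have hincr := chainingMajorant_add_norm_gridIncrement_le (μ := μ) (ℱ := ℱ) (T := T)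
        (X := X) (c := c) hp hw (show 2 * k + 1 < n * 2 ^ (N + 1) by rw [pow_succ] at hj ⊢; lia)
      simp only [gridIncrement, hright] at hincr
      exact ae_norm_le_condExp_of_add_norm_condExp_sub_le
        (ℱ.mono (hright ▸ (gridPoint.lt_succ hT hn _ _).le)) (ℱ.le _)
        (hX.integrable hp (gridPoint.le hk)) (hX.adapted _ (gridPoint.le hj))
        (hX.integrable hp (gridPoint.le hj)) (hS N) (hS (N + 1)) (ih _ hk)
        (Eventually.of_forall hincr)

lemma measure_exists_grid_le (hX : ConditionalIncrementControl μ ℱ T X p h A) (hp : 1 ≤ p)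
    (hA : 0 ≤ A) (hT : 0 < T) (hn : 0 < n) (hw : ∀ m, 0 < w m) {d ε : ℝ} (hε : 0 < ε) {N : ℕ}
    (hd : ∑ m ∈ Finset.range N, w (m + 1) ≤ d) :
    μ {ω | ∃ j ≤ n * 2 ^ N, c + d + ε ≤ ‖X (gridPoint T n N j) ω‖} ≤
      ENNReal.ofReal ((∫ ω, chainingError μ ℱ T X p c w n N ω ∂μ) / ε) := by
  refine (measure_mono ?_).trans (measure_exists_add_le_of_le_condExp ℱ (gridPoint.monotone N)
    (Eventually.of_forall (chainingError_nonneg (fun m => (hw m).le) N))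
    (hX.integrable_chainingError hp hA hT hn c w N) hε
    (hX.ae_norm_grid_le_condExp_chainingMajorant hp hA hT hn hw N))
  rintro ω ⟨j, hj, hle⟩
  exact ⟨j, hj, by linarith⟩

end ConditionalIncrementControl

end Chaining

/-- The ratio `2 ^ (1 / p - h)` of the chaining weights: its `p`-th power is the factor by which the
bound on the `p`-variation of the conditional increments decreases when the grid is refined. -/
noncomputable def chainingRatio (p h : ℝ) : ℝ := 2 ^ (1 / p - h)

/-- Geometric weights of total mass at most `a`, used for the refinements of the grid. -/
noncomputable def chainingWeight (p h a : ℝ) (N : ℕ) : ℝ :=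
  a * (1 - chainingRatio p h) * chainingRatio p h ^ N

section Weights

variable {p h a A T : ℝ}

lemma chainingRatio_pos : 0 < chainingRatio p h := Real.rpow_pos_of_pos two_pos _

lemma chainingRatio_lt_one (hp : 0 < p) (hph : 1 < p * h) : chainingRatio p h < 1 :=
  Real.rpow_lt_one_of_one_lt_of_neg one_lt_two (sub_neg_of_lt ((div_lt_iff₀' hp).2 hph))

lemma chainingRatio_pow_rpow (hp : p ≠ 0) (N : ℕ) :
    (chainingRatio p h ^ N) ^ p = ((2 : ℝ) ^ N) ^ (1 - p * h) := by
  rw [chainingRatio, ← Real.rpow_mul_natCast two_pos.le, ← Real.rpow_mul two_pos.le,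
    ← Real.rpow_natCast_mul two_pos.le]
  congr 1
  field_simp

lemma chainingWeight_pos (ha : 0 < a) (hp : 0 < p) (hph : 1 < p * h) (N : ℕ) :
    0 < chainingWeight p h a N :=
  mul_pos (mul_pos ha (sub_pos.2 (chainingRatio_lt_one hp hph))) (pow_pos chainingRatio_pos N)

lemma sum_chainingRatio_pow_succ_le (hp : 0 < p) (hph : 1 < p * h) (N : ℕ) :
    ∑ m ∈ Finset.range N, chainingRatio p h ^ (m + 1) ≤ (1 - chainingRatio p h)⁻¹ := by
  have hlt := chainingRatio_lt_one hp hph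
  calc ∑ m ∈ Finset.range N, chainingRatio p h ^ (m + 1)
    _ ≤ ∑ m ∈ Finset.range N, chainingRatio p h ^ m := Finset.sum_le_sum fun m _ =>
      pow_le_pow_of_le_one chainingRatio_pos.le hlt.le m.le_succ
    _ ≤ ∑' m : ℕ, chainingRatio p h ^ m :=
      (summable_geometric_of_lt_one chainingRatio_pos.le hlt).sum_le_tsum _
        fun m _ => pow_nonneg chainingRatio_pos.le m
    _ = _ := tsum_geometric_of_lt_one chainingRatio_pos.le hlt

lemma sum_chainingWeight_succ_le (ha : 0 ≤ a) (hp : 0 < p) (hph : 1 < p * h) (N : ℕ) :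
    ∑ m ∈ Finset.range N, chainingWeight p h a (m + 1) ≤ a := by
  have hpos : 0 < 1 - chainingRatio p h := sub_pos.2 (chainingRatio_lt_one hp hph)
  simp only [chainingWeight, ← Finset.mul_sum]
  calc _ ≤ a * (1 - chainingRatio p h) * (1 - chainingRatio p h)⁻¹ := by
        gcongr
        exact sum_chainingRatio_pow_succ_le hp hph N
    _ = a := mul_inv_cancel_right₀ hpos.ne' a

lemma chainingWeight_rpow_mul_eq (ha : 0 ≤ a) (hp : 0 < p) (hph : 1 < p * h) (hT : 0 ≤ T) {n : ℕ}
    (hn : 0 < n) (N : ℕ) :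
    chainingWeight p h a N ^ (1 - p) * ((n * 2 ^ N) * (A * (T / (n * 2 ^ N)) ^ (p * h))) =
      A * T ^ (p * h) * (a * (1 - chainingRatio p h)) ^ (1 - p) * (n : ℝ) ^ (1 - p * h) *
        chainingRatio p h ^ N := by
  have hpos : 0 ≤ 1 - chainingRatio p h := (sub_pos.2 (chainingRatio_lt_one hp hph)).le
  have hρN : 0 < chainingRatio p h ^ N := pow_pos chainingRatio_pos N
  have hcells : (0 : ℝ) < n * 2 ^ N := by positivity
  have hmesh : (n * 2 ^ N : ℝ) * (T / (n * 2 ^ N)) ^ (p * h) =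
      T ^ (p * h) * ((n : ℝ) ^ (1 - p * h) * (chainingRatio p h ^ N) ^ p) := by
    rw [chainingRatio_pow_rpow hp.ne', ← Real.mul_rpow n.cast_nonneg (by positivity),
      Real.div_rpow hT hcells.le, Real.rpow_sub hcells, Real.rpow_one]
    ring
  have hsplit : (chainingRatio p h ^ N) ^ (1 - p) * (chainingRatio p h ^ N) ^ p =
      chainingRatio p h ^ N := by
    rw [← Real.rpow_add hρN, sub_add_cancel, Real.rpow_one]
  rw [mul_left_comm _ A, hmesh, chainingWeight, Real.mul_rpow (by positivity) hρN.le]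
  linear_combination A * T ^ (p * h) * (a * (1 - chainingRatio p h)) ^ (1 - p) *
    (n : ℝ) ^ (1 - p * h) * hsplit

lemma sum_chainingWeight_rpow_mul_le (ha : 1 ≤ a) (hp : 1 ≤ p) (hph : 1 < p * h) (hA : 0 ≤ A)
    (hT : 0 ≤ T) {n : ℕ} (hn : 0 < n) (N : ℕ) :
    ∑ m ∈ Finset.range N, chainingWeight p h a (m + 1) ^ (1 - p) *
        ((n * 2 ^ (m + 1)) * (A * (T / (n * 2 ^ (m + 1))) ^ (p * h))) ≤
      A * T ^ (p * h) * (1 - chainingRatio p h) ^ (-p) * (n : ℝ) ^ (1 - p * h) := by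
  have hp_pos : 0 < p := by linarith
  have hpos : 0 < 1 - chainingRatio p h := sub_pos.2 (chainingRatio_lt_one hp_pos hph)
  have hfactor : (a * (1 - chainingRatio p h)) ^ (1 - p) ≤ (1 - chainingRatio p h) ^ (1 - p) :=
    Real.rpow_le_rpow_of_nonpos hpos (le_mul_of_one_le_left hpos.le ha) (by linarith)
  have hratio : 0 < chainingRatio p h := chainingRatio_pos
  have hpower : (1 - chainingRatio p h) ^ (-p) =
      (1 - chainingRatio p h) ^ (1 - p) * (1 - chainingRatio p h)⁻¹ := by
    rw [← Real.rpow_neg_one, ← Real.rpow_add hpos]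
    ring_nf
  simp only [chainingWeight_rpow_mul_eq (zero_le_one.trans ha) hp_pos hph hT hn, ← Finset.mul_sum]
  calc _ ≤ A * T ^ (p * h) * (1 - chainingRatio p h) ^ (1 - p) * (n : ℝ) ^ (1 - p * h) *
          (1 - chainingRatio p h)⁻¹ := by
        gcongr
        exact sum_chainingRatio_pow_succ_le hp_pos hph N
    _ = _ := by rw [hpower]; ring

end Weights

/-- The constant of the exponential maximal inequality `measure_iSup_le_mul_exp`: its first part
comes from the marginal tails on the initial grid, its second part from the increments. -/
noncomputable def maximalConst (p h α C₁ C₂ A T q : ℝ) : ℝ :=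
  3 * (C₂ * ∫ t in Set.Ioi (0 : ℝ), Real.exp (-(C₁ - q * C₁) * t ^ α)) +
    A * T ^ (p * h) * (1 - chainingRatio p h) ^ (-p)

lemma exists_nat_mul_exp_neg_add_mul_rpow_le {K L r y : ℝ} (hK : 0 ≤ K) (hL : 0 ≤ L) (hr : 1 ≤ r)
    (hy : 0 ≤ y) :
    ∃ n : ℕ, 0 < n ∧ (n + 1) * (K * Real.exp (-y)) + L * (n : ℝ) ^ (1 - r) ≤
      (3 * K + L) * Real.exp (-(1 - 1 / r) * y) := by
  have : 0 < r := by linarith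
  set e : ℝ := Real.exp (y / r)
  have he : 1 ≤ e := Real.one_le_exp (by positivity)
  have hn_le : (⌈e⌉₊ : ℝ) + 1 ≤ 3 * e := by linarith [Nat.ceil_lt_add_one (zero_le_one.trans he)]
  have htail : e * Real.exp (-y) = Real.exp (-(1 - 1 / r) * y) := by
    rw [← Real.exp_add]
    ring_nf
  have hincr : (⌈e⌉₊ : ℝ) ^ (1 - r) ≤ Real.exp (-(1 - 1 / r) * y) :=
    calc (⌈e⌉₊ : ℝ) ^ (1 - r) ≤ e ^ (1 - r) :=
        Real.rpow_le_rpow_of_nonpos (by positivity) (Nat.le_ceil e) (by linarith)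
      _ = Real.exp (-(1 - 1 / r) * y) := by
        rw [← Real.exp_mul]
        congr 1
        field_simp
        ring
  refine ⟨⌈e⌉₊, Nat.ceil_pos.2 (by positivity), ?_⟩
  calc (⌈e⌉₊ + 1) * (K * Real.exp (-y)) + L * (⌈e⌉₊ : ℝ) ^ (1 - r)
    _ ≤ 3 * e * (K * Real.exp (-y)) + L * Real.exp (-(1 - 1 / r) * y) := by gcongr
    _ = (3 * K + L) * Real.exp (-(1 - 1 / r) * y) := by rw [← htail]; ring

namespace ConditionalIncrementControl

variable {Ω E : Type*} {mΩ : MeasurableSpace Ω} [NormedAddCommGroup E] [NormedSpace ℝ E]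
  [CompleteSpace E] {μ : Measure Ω} [IsFiniteMeasure μ] {ℱ : Filtration ℝ≥0 mΩ} {T : ℝ≥0}
  {X : ℝ≥0 → Ω → E} {p h A : ℝ}

lemma measure_iSup_le_of_partition (hX : ConditionalIncrementControl μ ℱ T X p h A) (hp : 1 ≤ p)
    (hph : 1 < p * h) (hA : 0 ≤ A) (hT : 0 < T) {c a lam K : ℝ} (ha : 1 ≤ a) (hlam : 0 < lam)
    (hca : c + 2 * a < lam) (hK : ∀ t ≤ T, ∫ ω, max (‖X t ω‖ - c) 0 ∂μ ≤ K) {n : ℕ}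
    (hn : 0 < n) :
    μ {ω | ENNReal.ofReal lam ≤ ⨆ t ∈ Set.Icc (0 : ℝ≥0) T, ‖X t ω‖ₑ} ≤
      ENNReal.ofReal ((n + 1) * K +
        A * (T : ℝ) ^ (p * h) * (1 - chainingRatio p h) ^ (-p) * (n : ℝ) ^ (1 - p * h)) := by
  have hp_pos : 0 < p := by linarith
  have ha_pos : 0 < a := by linarith
  have hw := chainingWeight_pos ha_pos hp_pos hph
  refine gridPoint.measure_le_iSup_enorm_le hT hn hX.continuous_paths (r := c + a + a) hlam
    (by linarith) fun N => ?_
  refine (hX.measure_exists_grid_le hp hA hT hn hw ha_pos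
    (sum_chainingWeight_succ_le ha_pos.le hp_pos hph N)).trans (ENNReal.ofReal_le_ofReal ?_)
  calc (∫ ω, chainingError μ ℱ T X p c (chainingWeight p h a) n N ω ∂μ) / a
    _ ≤ ∫ ω, chainingError μ ℱ T X p c (chainingWeight p h a) n N ω ∂μ :=
      div_le_self (integral_nonneg (chainingError_nonneg (fun m => (hw m).le) N)) ha
    _ ≤ _ := hX.integral_chainingError_le hp hA hT hn (fun m => (hw m).le) hK N
    _ ≤ _ := by gcongr; exact sum_chainingWeight_rpow_mul_le ha hp hph hA T.coe_nonneg hn N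

lemma measure_iSup_le_mul_exp (hX : ConditionalIncrementControl μ ℱ T X p h A) {α C₁ C₂ q lam : ℝ}
    (hdecay : UniformExpMarginalDecay μ T X α C₁ C₂) (hp : 1 ≤ p) (hph : 1 < p * h) (hα : 0 < α)
    (hC₁ : 0 < C₁) (hC₂ : 0 ≤ C₂) (hA : 0 ≤ A) (hT : 0 < T) (hq : q ∈ Set.Ioo 0 1)
    (hlam : 3 / (1 - q) ≤ lam) :
    μ {ω | ENNReal.ofReal lam ≤ ⨆ t ∈ Set.Icc (0 : ℝ≥0) T, ‖X t ω‖ₑ} ≤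
      ENNReal.ofReal (maximalConst p h α C₁ C₂ A T q *
        Real.exp (-(C₁ * q ^ (1 + α) * (1 - 1 / (p * h))) * lam ^ α)) := by
  have hq_pos : 0 < q := hq.1
  have hgap : 3 ≤ (1 - q) * lam := (div_le_iff₀' (sub_pos.2 hq.2)).1 hlam
  have hlam_pos : 0 < lam := (div_pos three_pos (sub_pos.2 hq.2)).trans_le hlam
  have hratio : 0 < 1 - chainingRatio p h :=
    sub_pos.2 (chainingRatio_lt_one (by linarith) hph)
  set y : ℝ := q * C₁ * (q * lam) ^ α
  have hy : -(C₁ * q ^ (1 + α) * (1 - 1 / (p * h))) * lam ^ α = -(1 - 1 / (p * h)) * y := by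
    simp only [y]
    rw [Real.mul_rpow hq_pos.le hlam_pos.le, Real.rpow_add hq_pos, Real.rpow_one]
    ring
  have hexcess : ∀ t ≤ T, ∫ ω, max (‖X t ω‖ - q * lam) 0 ∂μ ≤
      (C₂ * ∫ t in Set.Ioi (0 : ℝ), Real.exp (-(C₁ - q * C₁) * t ^ α)) * Real.exp (-y) :=
    fun t ht => (integral_max_norm_sub_le_of_exp_tail (hX.integrable hp ht) hα (by positivity)
      (mul_lt_of_lt_one_left hC₁ hq.2) hC₂ (fun r hr => hdecay r hr t ht)
      (by positivity)).trans_eq (by rw [neg_mul])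
  obtain ⟨n, hn, hbalance⟩ := exists_nat_mul_exp_neg_add_mul_rpow_le
    (K := C₂ * ∫ t in Set.Ioi (0 : ℝ), Real.exp (-(C₁ - q * C₁) * t ^ α))
    (L := A * (T : ℝ) ^ (p * h) * (1 - chainingRatio p h) ^ (-p)) (y := y)
    (mul_nonneg hC₂ (integral_nonneg fun t => (Real.exp_pos _).le)) (by positivity) hph.le
    (by positivity)
  rw [hy]
  exact (hX.measure_iSup_le_of_partition hp hph hA hT (a := (1 - q) * lam / 3) (by linarith)
    hlam_pos (by linarith) hexcess hn).trans (ENNReal.ofReal_le_ofReal hbalance)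

end ConditionalIncrementControl

lemma exists_mem_Ioo_lt_mul_rpow {κ b : ℝ} (s : ℝ) (hκ : κ < b) :
    ∃ q ∈ Set.Ioo (0 : ℝ) 1, κ < b * q ^ s := by
  have hlim : Tendsto (fun q : ℝ => b * q ^ s) (𝓝[<] 1) (𝓝 b) := by
    have h := ((Real.continuousAt_rpow_const 1 s (Or.inl one_ne_zero)).const_mul b).tendsto
    rw [Real.one_rpow, mul_one] at h
    exact h.mono_left nhdsWithin_le_nhds
  exact (Eventually.and (Ioo_mem_nhdsLT one_pos) (hlim.eventually_const_lt hκ)).exists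

lemma eventually_mul_exp_neg_mul_rpow_le {κ κ' α C : ℝ} (M s : ℝ) (hκ : κ < κ') (hα : 0 < α)
    (hC : 0 < C) :
    ∀ᶠ x : ℝ in atTop, M * Real.exp (-κ' * x ^ α) ≤ C * x ^ s * Real.exp (-κ * x ^ α) := by
  have hlim := ((tendsto_rpow_mul_exp_neg_mul_atTop_nhds_zero (-s / α) (κ' - κ)
    (sub_pos.2 hκ)).comp (tendsto_rpow_atTop hα)).const_mul M
  rw [mul_zero] at hlim
  filter_upwards [hlim.eventually_le_const hC, eventually_gt_atTop 0] with x hx hx_pos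
  simp only [Function.comp_apply] at hx
  rw [← Real.rpow_mul hx_pos.le, mul_div_cancel₀ _ hα.ne'] at hx
  calc M * Real.exp (-κ' * x ^ α)
    _ = M * (x ^ (-s) * Real.exp (-(κ' - κ) * x ^ α)) * x ^ s * Real.exp (-κ * x ^ α) := by
      rw [Real.rpow_neg hx_pos.le, show -κ' * x ^ α = -(κ' - κ) * x ^ α + -κ * x ^ α by ring,
        Real.exp_add]
      field_simp
    _ ≤ C * x ^ s * Real.exp (-κ * x ^ α) := by gcongr

/-- The rate of decay may be any `κ < C₁ * (1 - 1 / (p * h))`; the room left in this inequality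
absorbs every constant `C > 0` and every power `lam ^ s`. -/
theorem theorem2_general {p h α C₁ C₂ A C κ : ℝ} (s : ℝ) (hp : 1 ≤ p) (hph : 1 < p * h)
    (hα : 0 < α) (hC₁ : 0 < C₁) (hC₂ : 0 ≤ C₂) (hA : 0 ≤ A) (hC : 0 < C)
    (hκ : κ < C₁ * (1 - 1 / (p * h))) {T : ℝ≥0} (hT : 0 < T) :
    ∃ lam₀ : ℝ, 0 < lam₀ ∧
      ∀ (Ω E : Type*) (mΩ : MeasurableSpace Ω) (μ : Measure Ω) (_ : IsFiniteMeasure μ)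
        (_ : NormedAddCommGroup E) (_ : NormedSpace ℝ E) (_ : CompleteSpace E)
        (ℱ : Filtration ℝ≥0 mΩ) (X : ℝ≥0 → Ω → E),
        ConditionalIncrementControl μ ℱ T X p h A →
        UniformExpMarginalDecay μ T X α C₁ C₂ →
        ∀ lam : ℝ, lam₀ ≤ lam →
          μ.real {ω | ENNReal.ofReal lam ≤ ⨆ t ∈ Set.Icc (0 : ℝ≥0) T, ‖X t ω‖ₑ}
            ≤ C * lam ^ s * Real.exp (-κ * lam ^ α) := by
  obtain ⟨q, hq, hκq⟩ := exists_mem_Ioo_lt_mul_rpow (1 + α) hκ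
  rw [mul_right_comm] at hκq
  obtain ⟨lam₁, hlam₁⟩ := eventually_atTop.1 (eventually_mul_exp_neg_mul_rpow_le
    (maximalConst p h α C₁ C₂ A T q) s hκq hα hC)
  have hlam₂ : 0 < 3 / (1 - q) := div_pos three_pos (sub_pos.2 hq.2)
  refine ⟨max lam₁ (3 / (1 - q)), lt_max_of_lt_right hlam₂, ?_⟩
  intro Ω E mΩ μ _ _ _ _ ℱ X hX hdecay lam hlam
  have hlam_pos : 0 < lam := hlam₂.trans_le (le_of_max_le_right hlam)
  refine ENNReal.toReal_le_of_le_ofReal (by positivity)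
    ((hX.measure_iSup_le_mul_exp hdecay hp hph hα hC₁ hC₂ hA hT hq
      (le_of_max_le_right hlam)).trans (ENNReal.ofReal_le_ofReal ?_))
  exact hlam₁ lam (le_of_max_le_left hlam)

lemma div_two_rpow_mul_lt {r s C : ℝ} (hr : 1 < r) (hs : 0 < s) (hC : 0 < C) :
    C / 2 ^ s * (1 - 1 / r) < C * (1 - 1 / r) :=
  mul_lt_mul_of_pos_right (div_lt_self hC (Real.one_lt_rpow one_lt_two hs))
    (sub_pos.2 ((div_lt_one (zero_lt_one.trans hr)).2 hr))

theorem theorem2 (p h α C₁ C₂ A : ℝ) (hp : 1 < p) (hh : 0 < h) (hh1 : h ≤ 1) (hph : 1 < p * h)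
    (hα : 0 < α) (hC₁ : 0 < C₁) (hC₂ : 0 < C₂) (hA : 0 ≤ A) :
    ∃ C : ℝ, 0 < C ∧ ∀ T : ℝ≥0, 0 < T → ∃ lam₀ : ℝ, 0 < lam₀ ∧
      ∀ (d : ℕ) (Ω : Type*) (mΩ : MeasurableSpace Ω) (μ : Measure Ω) (_ : IsProbabilityMeasure μ)
        (ℱ : Filtration ℝ≥0 mΩ) (X : ℝ≥0 → Ω → EuclideanSpace ℝ (Fin d)),
        UsualConditions μ ℱ →
        ConditionalIncrementControl μ ℱ T X p h A →
        UniformExpMarginalDecay μ T X α C₁ C₂ →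
        ∀ lam : ℝ, lam₀ ≤ lam →
          μ.real {ω | ENNReal.ofReal lam ≤ ⨆ t ∈ Set.Icc (0 : ℝ≥0) T, ‖X t ω‖ₑ}
            ≤ C * lam ^ (-1 / h) *
              Real.exp (-(C₁ / (2 : ℝ) ^ (α + 2)) * (1 - 1 / (p * h)) * lam ^ α) := by
  refine ⟨1, one_pos, fun T hT => ?_⟩
  obtain ⟨lam₀, hlam₀, hbound⟩ := theorem2_general (C₂ := C₂) (-1 / h) hp.le hph hα hC₁ hC₂.le hA
    one_pos (div_two_rpow_mul_lt (s := α + 2) hph (by positivity) hC₁) hT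
  exact ⟨lam₀, hlam₀, fun d Ω mΩ μ _ ℱ X _ hX hdecay => by
    simpa only [neg_mul] using hbound Ω _ mΩ μ inferInstance _ _ inferInstance ℱ X hX hdecay⟩
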